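/- Let $S_\infty$ be the group of permutations of $\{1,2,3,\dots\}$ that fix all but finitely many elements, let $s_i$ be the transposition of $i$ and $i+1$, and for $w\in S_\infty$ let $\mathrm{Des}(w)=\{i\ge 1 : w(i)>w(i+1)\}$ be its set of (right) descents. The Schubert polynomials $\mathfrak S_w\in\mathbb Z[x_1,x_2,\dots]$, $w\in S_\infty$, are defined recursively by $\mathfrak S_{w_0}=x_1^{n-1}x_2^{n-2}\cdots x_n^0$ for the long element $w_0=n(n-1)\cdots 1$ of $S_n\subset S_\infty$ and $$\mathfrak S_{ws_i}=N_i\mathfrak S_w \quad\text{for } i\in\mathrm{Des}(w),\qquad N_i(f)=\frac{f-s_i\cdot f}{x_i-x_{i+1}},$$ where $s_i$ acts on polynomials by swapping $x_i$ and $x_{i+1}$. The structure coefficients $c_{u,v}^w\in\mathbb Z$ are defined by $\mathfrak S_u\cdot\mathfrak S_v=\sum_{w\in S_\infty}c_{u,v}^w\,\mathfrak S_w$ (a finite sum). Let $u,v\in S_\infty$ and suppose $i\notin\mathrm{Des}(u)\cup\mathrm{Des}(v)$. Then the coefficients $c_{u,v}^w$ are well defined (there is exactly one finitely supported integer family with this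 expansion), and $c_{u,v}^p=0$ for all $p\in S_\infty$ with $i\in\mathrm{Des}(p)$. -/

import Mathlib

open MvPolynomial

namespace Schubert

/-- The infinite symmetric group: the permutations that move only finitely many letters.
Letters, positions and variables are numbered from `0`: the natural number `k` stands for
the positive integer `k + 1`. -/
def SInf : Subgroup (Equiv.Perm ℕ) where
  carrier := {w | {k | w k ≠ k}.Finite}
  one_mem' := by simp
  mul_mem' := by
    intro a b ha hb
    refine (ha.union hb).subset ?_
    intro k hk
    by_contra h
    rw [Set.mem_union, not_or] at h
    exact hk (by rw [Equiv.Perm.mul_apply, not_not.1 h.2, not_not.1 h.1])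
  inv_mem' := by
    intro a ha
    refine Set.Finite.subset ha ?_
    intro k hk h
    exact hk (by rw [Equiv.Perm.inv_eq_iff_eq]; exact h.symm)

/-- The simple transposition that swaps `i` and `i + 1`. -/
def s (i : ℕ) : SInf :=
  ⟨Equiv.swap i (i + 1), by
    refine (Set.toFinite {i, i + 1}).subset ?_
    intro k hk
    by_contra h
    simp only [Set.mem_insert_iff, Set.mem_singleton_iff, not_or] at h
    exact hk (Equiv.swap_apply_of_ne_of_ne h.1 h.2)⟩

/-- The long element of the symmetric group on the first `n` letters. -/
def w₀ (n : ℕ) : SInf :=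
  ⟨Function.Involutive.toPerm (fun k => if k < n then n - 1 - k else k) (by
      intro k
      by_cases h : k < n
      · have h' : n - 1 - k < n := by omega
        simp only [h, h', if_true]
        omega
      · simp [h]), by
    refine (Set.finite_lt_nat n).subset ?_
    intro k hk
    by_contra h
    exact hk (if_neg h)⟩

/-- The set of (right) descents of `w`. -/
def Des (w : SInf) : Set ℕ :=
  {i | w.1 (i + 1) < w.1 i}

theorem X_sub_X_dvd (i : ℕ) (f : MvPolynomial ℕ ℤ) :
    (X i - X (i + 1) : MvPolynomial ℕ ℤ) ∣ f - rename (Equiv.swap i (i + 1)) f := by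
  induction f using MvPolynomial.induction_on with
  | C a => simp
  | add p q hp hq =>
    rw [map_add, add_sub_add_comm]
    exact dvd_add hp hq
  | mul_X p k hp =>
    have hk : (X i - X (i + 1) : MvPolynomial ℕ ℤ) ∣ X k - X (Equiv.swap i (i + 1) k) := by
      by_cases h1 : k = i
      · subst h1
        simp
      · by_cases h2 : k = i + 1
        · subst h2
          rw [Equiv.swap_apply_right]
          exact ⟨-1, by ring⟩
        · rw [Equiv.swap_apply_of_ne_of_ne h1 h2]
          simp
    have e : p * X k - rename (Equiv.swap i (i + 1)) (p * X k)
        = (p - rename (Equiv.swap i (i + 1)) p) * X k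
          + rename (Equiv.swap i (i + 1)) p * (X k - X (Equiv.swap i (i + 1) k)) := by
      rw [map_mul, rename_X]
      ring
    rw [e]
    exact dvd_add (hp.mul_right _) (hk.mul_left _)

/-- The divided difference operator `f ↦ (f - s_i f) / (x_i - x_{i+1})`: the unique polynomial
whose product with `x_i - x_{i+1}` is `f - s_i f`. -/
noncomputable def N (i : ℕ) (f : MvPolynomial ℕ ℤ) : MvPolynomial ℕ ℤ :=
  (X_sub_X_dvd i f).choose

theorem X_sub_X_mul_N (i : ℕ) (f : MvPolynomial ℕ ℤ) :
    (X i - X (i + 1)) * N i f = f - rename (Equiv.swap i (i + 1)) f :=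
  (X_sub_X_dvd i f).choose_spec.symm

/-- `IsSchubert w f` says that the recursive definition of Schubert polynomials yields the
polynomial `f` for the permutation `w`: it yields `x_1^(n-1) x_2^(n-2) ⋯ x_n^0` for the long
element on `n` letters, and if it yields `f` for `w`, it yields `N_i f` for `w s_i` whenever
`i` is a descent of `w`. -/
inductive IsSchubert : SInf → MvPolynomial ℕ ℤ → Prop
  | long (n : ℕ) : IsSchubert (w₀ n) (∏ k ∈ Finset.range n, X k ^ (n - 1 - k))
  | step {w : SInf} {f : MvPolynomial ℕ ℤ} (i : ℕ) (hf : IsSchubert w f) (hi : i ∈ Des w) :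
      IsSchubert (w * s i) (N i f)

theorem exists_isSchubert (w : SInf) : ∃ f, IsSchubert w f := by
  obtain ⟨n, hn⟩ : ∃ n, ∀ k, n ≤ k → w.1 k = k := by
    obtain ⟨b, hb⟩ := Set.Finite.bddAbove (show {k | w.1 k ≠ k}.Finite from w.2)
    refine ⟨b + 1, fun k hk => ?_⟩
    by_contra h
    have := hb h
    omega
  induction hm : ∑ k ∈ Finset.range n, k * w.1 k using Nat.strong_induction_on generalizing w with
  | _ m ih =>
  by_cases h : ∃ i, i + 1 < n ∧ w.1 i < w.1 (i + 1)
  · obtain ⟨i, hin, hi⟩ := h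
    have hs0 : (w * s i).1 i = w.1 (i + 1) := by
      simp [s]
    have hs1 : (w * s i).1 (i + 1) = w.1 i := by
      simp [s]
    have hs2 : ∀ k, k ≠ i → k ≠ i + 1 → (w * s i).1 k = w.1 k := by
      intro k h1 h2
      simp [s, Equiv.swap_apply_of_ne_of_ne h1 h2]
    have hlt : ∑ k ∈ Finset.range n, k * (w * s i).1 k < m := by
      rw [← hm]
      have hA : i ∈ Finset.range n := Finset.mem_range.2 (by omega)
      have hB : i + 1 ∈ (Finset.range n).erase i :=
        Finset.mem_erase.2 ⟨by omega, Finset.mem_range.2 hin⟩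
      rw [← Finset.add_sum_erase _ _ hA, ← Finset.add_sum_erase _ _ hB,
        ← Finset.add_sum_erase _ (fun k => k * w.1 k) hA,
        ← Finset.add_sum_erase _ (fun k => k * w.1 k) hB, hs0, hs1]
      have : ∑ k ∈ ((Finset.range n).erase i).erase (i + 1), k * (w * s i).1 k
          = ∑ k ∈ ((Finset.range n).erase i).erase (i + 1), k * w.1 k := by
        refine Finset.sum_congr rfl fun k hk => ?_
        simp only [Finset.mem_erase] at hk
        rw [hs2 k hk.2.1 hk.1]
      rw [this]
      nlinarith
    obtain ⟨f, hf⟩ := ih _ hlt (w * s i)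
      (fun k hk => by rw [hs2 k (by omega) (by omega)]; exact hn k hk) rfl
    have hd : i ∈ Des (w * s i) := by
      change (w * s i).1 (i + 1) < (w * s i).1 i
      rw [hs0, hs1]
      exact hi
    have := IsSchubert.step i hf hd
    have e : w * s i * s i = w := by
      rw [mul_assoc]
      have : s i * s i = 1 := by
        apply Subtype.ext
        simp [s]
      rw [this, mul_one]
    rw [e] at this
    exact ⟨_, this⟩
  · push Not at h
    have hinj := w.1.injective
    have hlt : ∀ k, k < n → w.1 k < n := by
      intro k hk
      by_contra hge
      have := hinj (hn _ (not_lt.1 hge))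
      omega
    have hdesc : ∀ i, i + 1 < n → w.1 (i + 1) < w.1 i := fun i hi =>
      lt_of_le_of_ne (h i hi) (fun e => by have := hinj e; omega)
    have hup : ∀ k, k < n → w.1 k + k ≤ n - 1 := by
      intro k
      induction k with
      | zero => intro hk; have := hlt 0 hk; omega
      | succ k ihk => intro hk; have := ihk (by omega); have := hdesc k hk; omega
    have hlow : ∀ j k, k + j + 1 = n → j ≤ w.1 k := by
      intro j
      induction j with
      | zero => intro k _; omega
      | succ j ihj =>
        intro k hk
        have := ihj (k + 1) (by omega)
        have := hdesc k (by omega)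
        omega
    have e : w = w₀ n := by
      apply Subtype.ext
      ext k
      change w.1 k = if k < n then n - 1 - k else k
      split_ifs with hk
      · have := hup k hk
        have := hlow (n - 1 - k) k (by omega)
        omega
      · exact hn k (by omega)
    exact ⟨_, e ▸ IsSchubert.long n⟩

/-- The Schubert polynomial of `w`. -/
noncomputable def schubert (w : SInf) : MvPolynomial ℕ ℤ :=
  (exists_isSchubert w).choose

/-- `c` is a family of coefficients of the expansion `𝔖_u 𝔖_v = ∑_w c_w 𝔖_w`. -/
def IsExpansion (u v : SInf) (c : SInf →₀ ℤ) : Prop :=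
  schubert u * schubert v = c.sum fun w a => a • schubert w

/-- The structure coefficients `c_{u,v}^w` of the Schubert polynomials, as a family indexed by
`w`. -/
noncomputable def structureCoeff (u v : SInf) : SInf →₀ ℤ :=
  Classical.epsilon (IsExpansion u v)

end Schubert

open MvPolynomial

namespace Schubert

/-! The coefficient of `𝔖_w` in a polynomial `f` is the constant term of `N_{i_1} ⋯ N_{i_k} f`, for
any reduced word `w = s_{i_1} ⋯ s_{i_k}`. If `i` is a descent of `p`, the word for `p` may be chosen
to end in `s_i`, so the coefficient at `p` depends only on `N_i f`. For `i` outside `Des u ∪ Des v`,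
both `𝔖_u` and `𝔖_v` are symmetric in `x_i, x_{i+1}`; hence so is their product, and `N_i` kills it.

The coefficient formula rests on three facts. The `N_i` satisfy the commutation and braid relations
(`N_comm`, `N_braid`), so the functional `dual w` does not depend on the reduced word
(`IsWordValue.unique`). Schubert polynomials are independent of the choices in their recursion
(`IsSchubert.unique`), which gives the duality `dual_schubert`. Finally, only finitely many
functionals are nonzero on a given `f`, and jointly they separate polynomials, so every `f` has
exactly one expansion (`eq_sum_schubert_iff`). -/

/-! ### Divided differences: relations, degree, common kernel. -/

theorem X_sub_X_ne_zero {i j : ℕ} (h : i ≠ j) : (X i - X j : MvPolynomial ℕ ℤ) ≠ 0 :=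
  sub_ne_zero.2 fun e => h (X_injective e)

theorem N_eq_iff {i : ℕ} {f g : MvPolynomial ℕ ℤ} :
    N i f = g ↔ (X i - X (i + 1)) * g = f - rename (Equiv.swap i (i + 1)) f := by
  rw [← X_sub_X_mul_N]
  exact ⟨fun h => by rw [h], fun h => (mul_left_cancel₀ (X_sub_X_ne_zero (by omega)) h).symm⟩

theorem rename_perm_mul (a b : Equiv.Perm ℕ) (f : MvPolynomial ℕ ℤ) :
    rename a (rename b f) = rename (a * b : Equiv.Perm ℕ) f := by
  rw [rename_rename, Equiv.Perm.coe_mul]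

theorem N_eq_zero_iff {i : ℕ} {f : MvPolynomial ℕ ℤ} :
    N i f = 0 ↔ rename (Equiv.swap i (i + 1)) f = f := by
  rw [N_eq_iff, mul_zero, eq_comm, sub_eq_zero, eq_comm]

/-- The divided difference operator as a linear map. -/
noncomputable def NLin (i : ℕ) : MvPolynomial ℕ ℤ →ₗ[ℤ] MvPolynomial ℕ ℤ where
  toFun := N i
  map_add' f g := by
    rw [N_eq_iff, mul_add, X_sub_X_mul_N, X_sub_X_mul_N, map_add]
    ring
  map_smul' a f := by
    rw [N_eq_iff, RingHom.id_apply, mul_smul_comm, X_sub_X_mul_N, map_smul, smul_sub]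

@[simp]
theorem NLin_apply (i : ℕ) (f : MvPolynomial ℕ ℤ) : NLin i f = N i f := rfl

theorem N_mul_of_rename_eq {i : ℕ} {f g : MvPolynomial ℕ ℤ}
    (hg : rename (Equiv.swap i (i + 1)) g = g) : N i (f * g) = N i f * g := by
  rw [N_eq_iff, ← mul_assoc, X_sub_X_mul_N, map_mul, hg, sub_mul]

theorem rename_N (i : ℕ) (f : MvPolynomial ℕ ℤ) :
    rename (Equiv.swap i (i + 1)) (N i f) = N i f := by
  have h := congrArg (rename (Equiv.swap i (i + 1))) (X_sub_X_mul_N i f)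
  rw [map_mul, map_sub, map_sub, rename_X, rename_X, rename_perm_mul, Equiv.swap_mul_self,
    Equiv.swap_apply_left, Equiv.swap_apply_right, Equiv.Perm.coe_one, rename_id_apply] at h
  rw [eq_comm, N_eq_iff]
  linear_combination -h

theorem N_N_self (i : ℕ) (f : MvPolynomial ℕ ℤ) : N i (N i f) = 0 :=
  N_eq_zero_iff.2 (rename_N i f)

/-- Clearing both denominators turns each side into the same alternating sum over the group
generated by the two disjoint swaps. -/
theorem N_comm {i j : ℕ} (h : i + 1 < j) (f : MvPolynomial ℕ ℤ) :
    N i (N j f) = N j (N i f) := by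
  have key : ∀ a b : ℕ, (a + 1 < b ∨ b + 1 < a) →
      (X a - X (a + 1)) * ((X b - X (b + 1)) * N a (N b f))
        = f - rename (Equiv.swap b (b + 1)) f - rename (Equiv.swap a (a + 1)) f
          + rename (Equiv.swap a (a + 1) * Equiv.swap b (b + 1) : Equiv.Perm ℕ) f := by
    intro a b hab
    have h1 := X_sub_X_mul_N a (N b f)
    have h2 := X_sub_X_mul_N b f
    have h3 := congrArg (rename (Equiv.swap a (a + 1))) h2
    rw [map_mul, map_sub, map_sub, rename_X, rename_X, rename_perm_mul,
      Equiv.swap_apply_of_ne_of_ne (by omega) (by omega),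
      Equiv.swap_apply_of_ne_of_ne (by omega) (by omega)] at h3
    linear_combination (X b - X (b + 1)) * h1 + h2 - h3
  have e : (Equiv.swap i (i + 1) * Equiv.swap j (j + 1) : Equiv.Perm ℕ)
      = Equiv.swap j (j + 1) * Equiv.swap i (i + 1) := by
    refine Equiv.Perm.Disjoint.commute fun k => ?_
    by_cases hk : k = i ∨ k = i + 1
    · exact Or.inr (Equiv.swap_apply_of_ne_of_ne (by omega) (by omega))
    · exact Or.inl (Equiv.swap_apply_of_ne_of_ne (by omega) (by omega))
  have h1 := key i j (by omega)
  have h2 := key j i (by omega)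
  rw [e] at h1
  refine mul_left_cancel₀ (X_sub_X_ne_zero (show i ≠ i + 1 by omega))
    (mul_left_cancel₀ (X_sub_X_ne_zero (show j ≠ j + 1 by omega)) ?_)
  linear_combination h1 - h2

theorem swap_braid (i : ℕ) :
    (Equiv.swap i (i + 1) * (Equiv.swap (i + 1) (i + 2) * Equiv.swap i (i + 1)) : Equiv.Perm ℕ)
      = Equiv.swap (i + 1) (i + 2) * (Equiv.swap i (i + 1) * Equiv.swap (i + 1) (i + 2)) := by
  ext k
  simp only [Equiv.Perm.mul_apply, Equiv.swap_apply_def]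
  grind

/-- Multiplied by the Vandermonde product in the three variables, each side becomes the alternating
sum of `f` over the symmetric group on these variables. -/
theorem N_braid (i : ℕ) (f : MvPolynomial ℕ ℤ) :
    N i (N (i + 1) (N i f)) = N (i + 1) (N i (N (i + 1) f)) := by
  have s0 : Equiv.swap i (i + 1) (i + 2) = i + 2 :=
    Equiv.swap_apply_of_ne_of_ne (by omega) (by omega)
  have t0 : Equiv.swap (i + 1) (i + 2) i = i :=
    Equiv.swap_apply_of_ne_of_ne (by omega) (by omega)
  have key1 : (X i - X (i + 1)) * ((X i - X (i + 2)) * ((X (i + 1) - X (i + 2)) *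
      N i (N (i + 1) (N i f)))) = f - rename (Equiv.swap i (i + 1)) f
        - rename (Equiv.swap (i + 1) (i + 2)) f
        + rename (Equiv.swap i (i + 1) * Equiv.swap (i + 1) (i + 2) : Equiv.Perm ℕ) f
        + rename (Equiv.swap (i + 1) (i + 2) * Equiv.swap i (i + 1) : Equiv.Perm ℕ) f
        - rename (Equiv.swap i (i + 1) * (Equiv.swap (i + 1) (i + 2) * Equiv.swap i (i + 1)) :
            Equiv.Perm ℕ) f := by
    have h1 := X_sub_X_mul_N i f
    have h1t := congrArg (rename (Equiv.swap (i + 1) (i + 2))) h1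
    have h1st := congrArg (rename (Equiv.swap i (i + 1))) h1t
    have h2 := X_sub_X_mul_N (i + 1) (N i f)
    have h2s := congrArg (rename (Equiv.swap i (i + 1))) h2
    have h3 := X_sub_X_mul_N i (N (i + 1) (N i f))
    simp only [map_mul, map_sub, rename_X, rename_perm_mul, Equiv.swap_apply_left,
      Equiv.swap_apply_right, s0, t0, add_assoc, Nat.reduceAdd] at h1t h1st h2 h2s h3
    -- `N i f` is fixed by the swap, so the term it contributes to `h2` and `h2s` cancels in the
    -- combination up to the factor that `h1` clears.
    rw [rename_N] at h2s
    linear_combination (X i - X (i + 2)) * (X (i + 1) - X (i + 2)) * h3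
      + (X i - X (i + 2)) * h2 - (X (i + 1) - X (i + 2)) * h2s + h1 - h1t + h1st
  have key2 : (X i - X (i + 1)) * ((X i - X (i + 2)) * ((X (i + 1) - X (i + 2)) *
      N (i + 1) (N i (N (i + 1) f)))) = f - rename (Equiv.swap i (i + 1)) f
        - rename (Equiv.swap (i + 1) (i + 2)) f
        + rename (Equiv.swap i (i + 1) * Equiv.swap (i + 1) (i + 2) : Equiv.Perm ℕ) f
        + rename (Equiv.swap (i + 1) (i + 2) * Equiv.swap i (i + 1) : Equiv.Perm ℕ) f
        - rename (Equiv.swap (i + 1) (i + 2) * (Equiv.swap i (i + 1) *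
            Equiv.swap (i + 1) (i + 2)) : Equiv.Perm ℕ) f := by
    have h1 := X_sub_X_mul_N (i + 1) f
    have h1s := congrArg (rename (Equiv.swap i (i + 1))) h1
    have h1ts := congrArg (rename (Equiv.swap (i + 1) (i + 2))) h1s
    have h2 := X_sub_X_mul_N i (N (i + 1) f)
    have h2t := congrArg (rename (Equiv.swap (i + 1) (i + 2))) h2
    have h3 := X_sub_X_mul_N (i + 1) (N i (N (i + 1) f))
    have hN := rename_N (i + 1) f
    simp only [map_mul, map_sub, rename_X, rename_perm_mul, Equiv.swap_apply_left,
      Equiv.swap_apply_right, s0, t0, add_assoc, Nat.reduceAdd] at h1 h1s h1ts h2 h2t h3 hN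
    rw [hN] at h2t
    linear_combination (X i - X (i + 1)) * (X i - X (i + 2)) * h3
      + (X i - X (i + 2)) * h2 - (X i - X (i + 1)) * h2t + h1 - h1s + h1ts
  rw [swap_braid] at key1
  have := key1.trans key2.symm
  exact mul_left_cancel₀ (X_sub_X_ne_zero (by omega)) (mul_left_cancel₀
    (X_sub_X_ne_zero (by omega)) (mul_left_cancel₀ (X_sub_X_ne_zero (by omega)) this))

theorem totalDegree_N_lt {i : ℕ} {f : MvPolynomial ℕ ℤ} (h : N i f ≠ 0) :
    (N i f).totalDegree < f.totalDegree := by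
  have h1 : (X i - X (i + 1) : MvPolynomial ℕ ℤ).totalDegree = 1 :=
    ((isHomogeneous_X ℤ i).sub (isHomogeneous_X ℤ (i + 1))).totalDegree
      (X_sub_X_ne_zero (by omega))
  have h2 := totalDegree_mul_of_isDomain (X_sub_X_ne_zero (show i ≠ i + 1 by omega)) h
  have h3 := totalDegree_sub f (rename (Equiv.swap i (i + 1)) f)
  have h4 := totalDegree_rename_le (Equiv.swap i (i + 1)) f
  rw [X_sub_X_mul_N, h1] at h2
  omega

theorem homogeneousComponent_mul_of_isHomogeneous_one {L : MvPolynomial ℕ ℤ}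
    (hL : L.IsHomogeneous 1) (k : ℕ) (h : MvPolynomial ℕ ℤ) :
    homogeneousComponent (1 + k) (L * h) = L * homogeneousComponent k h := by
  conv_lhs => rw [← sum_homogeneousComponent h, Finset.mul_sum, map_sum]
  have : ∀ m, homogeneousComponent (1 + k) (L * homogeneousComponent m h)
      = if m = k then L * homogeneousComponent k h else 0 := by
    intro m
    rw [homogeneousComponent_of_mem
      ((mem_homogeneousSubmodule _ _).2 (hL.mul (homogeneousComponent_isHomogeneous m h)))]
    by_cases hm : m = k
    · simp [hm]
    · rw [if_neg (by omega), if_neg hm]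
  simp only [this, Finset.sum_ite_eq', Finset.mem_range]
  split_ifs with hk
  · rfl
  · rw [homogeneousComponent_eq_zero _ _ (by omega), mul_zero]

theorem exists_isHomogeneous_N {d : ℕ} {f : MvPolynomial ℕ ℤ} (hf : f.IsHomogeneous d) (i : ℕ) :
    ∃ e, (N i f).IsHomogeneous e := by
  by_cases h0 : N i f = 0
  · exact ⟨0, h0 ▸ isHomogeneous_zero ℕ ℤ 0⟩
  obtain ⟨k, rfl⟩ : ∃ k, d = 1 + k := by
    have := totalDegree_N_lt h0
    have := hf.totalDegree_le
    exact ⟨d - 1, by omega⟩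
  have hL := (isHomogeneous_X ℤ i).sub (isHomogeneous_X ℤ (i + 1))
  have h1 := homogeneousComponent_mul_of_isHomogeneous_one hL k (N i f)
  rw [X_sub_X_mul_N, homogeneousComponent_eq_self (hf.sub hf.rename_isHomogeneous)] at h1
  rw [N_eq_iff.2 h1.symm]
  exact ⟨k, homogeneousComponent_isHomogeneous k _⟩

theorem finite_N_ne_zero (f : MvPolynomial ℕ ℤ) : {i | N i f ≠ 0}.Finite := by
  obtain ⟨b, hb⟩ := f.vars.bddAbove
  refine (Set.finite_le_nat b).subset fun i hi => ?_
  by_contra hib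
  refine hi (N_eq_zero_iff.2 ?_)
  have : (rename (Equiv.swap i (i + 1)) : MvPolynomial ℕ ℤ →ₐ[ℤ] _).toRingHom f
      = RingHom.id _ f := by
    refine hom_congr_vars (by ext; simp) (fun k hk _ => ?_) rfl
    have := hb hk
    rw [Set.mem_ofPred_eq] at hib
    simp [Equiv.swap_apply_of_ne_of_ne (show k ≠ i by omega) (show k ≠ i + 1 by omega)]
  exact this

/-- Such an `f` is invariant under all adjacent swaps; if `K` were its largest variable index,
swapping `K` and `K + 1` would show that `K + 1` occurs too. -/
theorem eq_C_of_forall_N_eq_zero {f : MvPolynomial ℕ ℤ} (h : ∀ i, N i f = 0) :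
    f = C (f.coeff 0) := by
  rw [← vars_eq_empty_iff_eq_C, ← Finset.not_nonempty_iff_eq_empty]
  intro hne
  have hm := f.vars.max'_mem hne
  set K := f.vars.max' hne
  have hK := N_eq_zero_iff.1 (h K)
  rw [← hK] at hm
  obtain ⟨j, hj, e⟩ := mem_vars_rename _ _ hm
  have : j = K + 1 := by
    rw [Equiv.swap_apply_eq_iff.1 e, Equiv.swap_apply_left]
  have := f.vars.le_max' j hj
  omega

/-! ### Descents and a measure for induction on permutations. -/

theorem mul_s_apply (w : SInf) (i k : ℕ) : (w * s i).1 k = w.1 (Equiv.swap i (i + 1) k) := rfl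

theorem coe_s (i : ℕ) : (s i).1 = Equiv.swap i (i + 1) := rfl

theorem s_mul_s (i : ℕ) : s i * s i = 1 :=
  Subtype.ext (Equiv.swap_mul_self i (i + 1))

@[simp]
theorem mul_s_mul_s (w : SInf) (i : ℕ) : w * s i * s i = w := by
  rw [mul_assoc, s_mul_s, mul_one]

theorem mem_Des_iff {w : SInf} {i : ℕ} : i ∈ Des w ↔ w.1 (i + 1) < w.1 i := Iff.rfl

theorem mem_Des_mul_s {w : SInf} {i : ℕ} : i ∈ Des (w * s i) ↔ i ∉ Des w := by
  have : w.1 i ≠ w.1 (i + 1) := fun e => by have := w.1.injective e; omega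
  rw [mem_Des_iff, mem_Des_iff, mul_s_apply, mul_s_apply, Equiv.swap_apply_left,
    Equiv.swap_apply_right]
  omega

theorem mul_s_comm {i j : ℕ} (h : i + 1 < j) (w : SInf) : w * s i * s j = w * s j * s i := by
  apply Subtype.ext
  ext k
  simp only [mul_s_apply, Equiv.swap_apply_def]
  grind

theorem mul_s_braid (i : ℕ) (w : SInf) :
    w * s i * s (i + 1) * s i = w * s (i + 1) * s i * s (i + 1) := by
  apply Subtype.ext
  ext k
  simp only [mul_s_apply, Equiv.swap_apply_def]
  grind

theorem exists_fixed (w : SInf) : ∃ n, ∀ k, n ≤ k → w.1 k = k := by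
  obtain ⟨b, hb⟩ := Set.Finite.bddAbove (show {k | w.1 k ≠ k}.Finite from w.2)
  refine ⟨b + 1, fun k hk => ?_⟩
  by_contra h
  have := hb h
  omega

theorem eq_one_of_Des_eq_empty {w : SInf} (h : ∀ i, i ∉ Des w) : w = 1 := by
  have hm : StrictMono w.1 := strictMono_nat_of_lt_succ fun i => by
    have : w.1 i ≠ w.1 (i + 1) := fun e => by have := w.1.injective e; omega
    have := h i
    rw [mem_Des_iff] at this
    omega
  have hm' : StrictMono w.1.symm := fun a b hab => by
    rw [← hm.lt_iff_lt]
    simpa using hab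
  apply Subtype.ext
  ext k
  have h1 := hm.le_apply (x := k)
  have h2 := hm'.le_apply (x := w.1 k)
  rw [Equiv.symm_apply_apply] at h2
  exact le_antisymm h2 h1

/-- The sum of the squared displacements of `w`. -/
noncomputable def displacement (w : SInf) : ℕ :=
  ∑ᶠ k, ((w.1 k : ℤ) - k).natAbs ^ 2

theorem displacement_eq_sum {w : SInf} {n : ℕ} (hn : ∀ k, n ≤ k → w.1 k = k) :
    displacement w = ∑ k ∈ Finset.range n, ((w.1 k : ℤ) - k).natAbs ^ 2 := by
  refine finsum_eq_sum_of_support_subset _ fun k hk => ?_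
  rw [Finset.coe_range, Set.mem_Iio]
  by_contra h
  exact hk (by simp [hn k (not_lt.1 h)])

/-- Sorting a descent lowers the sum by `2 (w i - w (i + 1))`. This makes `displacement` a
substitute for Coxeter length in inductions. -/
theorem displacement_mul_s_lt {w : SInf} {i : ℕ} (hi : i ∈ Des w) :
    displacement (w * s i) < displacement w := by
  obtain ⟨n, hn⟩ : ∃ n, i + 1 < n ∧ ∀ k, n ≤ k → w.1 k = k := by
    obtain ⟨n, hn⟩ := exists_fixed w
    exact ⟨n + i + 2, by omega, fun k hk => hn k (by omega)⟩
  have hs : ∀ k, k ≠ i → k ≠ i + 1 → (w * s i).1 k = w.1 k := fun k h1 h2 => by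
    rw [mul_s_apply, Equiv.swap_apply_of_ne_of_ne h1 h2]
  rw [displacement_eq_sum hn.2, displacement_eq_sum (n := n)
    (fun k hk => by rw [hs k (by omega) (by omega), hn.2 k hk])]
  have hA : i ∈ Finset.range n := Finset.mem_range.2 (by omega)
  have hB : i + 1 ∈ (Finset.range n).erase i :=
    Finset.mem_erase.2 ⟨by omega, Finset.mem_range.2 hn.1⟩
  rw [← Finset.add_sum_erase _ _ hA, ← Finset.add_sum_erase _ _ hB,
    ← Finset.add_sum_erase _ _ hA, ← Finset.add_sum_erase _ _ hB, ← add_assoc, ← add_assoc]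
  refine add_lt_add_of_lt_of_le ?_ (Finset.sum_le_sum fun k hk => ?_)
  · rw [mul_s_apply, mul_s_apply, Equiv.swap_apply_left, Equiv.swap_apply_right]
    rw [mem_Des_iff] at hi
    zify
    simp only [sq_abs]
    nlinarith
  · simp only [Finset.mem_erase] at hk
    rw [hs k hk.2.1 hk.1]

/-! ### Operators indexed by reduced words. -/

/-- The relation `x = op_{i_1} (⋯ (op_{i_k} x₀))` for some reduced word
`w = s_{i_k} ⋯ s_{i_1}`. -/
inductive IsWordValue {α : Type*} (op : ℕ → α → α) (x₀ : α) : SInf → α → Prop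
  | one : IsWordValue op x₀ 1 x₀
  | step {w : SInf} {x : α} {i : ℕ} (hi : i ∈ Des w) (hx : IsWordValue op x₀ (w * s i) x) :
      IsWordValue op x₀ w (op i x)

section WordValue

variable {α : Type*} {op : ℕ → α → α}

theorem exists_isWordValue (op : ℕ → α → α) (x₀ : α) (w : SInf) :
    ∃ x, IsWordValue op x₀ w x := by
  induction hm : displacement w using Nat.strong_induction_on generalizing w with
  | _ m ih =>
  by_cases h : ∃ i, i ∈ Des w
  · obtain ⟨i, hi⟩ := h
    obtain ⟨x, hx⟩ := ih _ (hm ▸ displacement_mul_s_lt hi) _ rfl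
    exact ⟨_, .step hi hx⟩
  · rw [eq_one_of_Des_eq_empty (not_exists.1 h)]
    exact ⟨_, .one⟩

/-- A diamond argument: two descents of `w` are compared through a common smaller permutation, `w
s_i s_j` if they are far apart and `w s_i s_{i+1} s_i` if adjacent. By induction both values then
pass through it, and a single commutation or braid relation matches them. -/
theorem IsWordValue.unique
    (hcomm : ∀ i j, i + 1 < j → ∀ x, op i (op j x) = op j (op i x))
    (hbraid : ∀ i x, op i (op (i + 1) (op i x)) = op (i + 1) (op i (op (i + 1) x)))
    {x₀ : α} {w : SInf} {x y : α} (hx : IsWordValue op x₀ w x) (hy : IsWordValue op x₀ w y) :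
    x = y := by
  induction hm : displacement w using Nat.strong_induction_on generalizing w x y with
  | _ m ih =>
  have IH : ∀ {i x y}, i ∈ Des w → IsWordValue op x₀ (w * s i) x →
      IsWordValue op x₀ (w * s i) y → x = y :=
    fun hi h1 h2 => ih _ (hm ▸ displacement_mul_s_lt hi) h1 h2 rfl
  have far : ∀ {i j x y}, i + 1 < j → i ∈ Des w → j ∈ Des w → IsWordValue op x₀ (w * s i) x →
      IsWordValue op x₀ (w * s j) y → op i x = op j y := by
    intro i j x y hij hi hj hx hy
    obtain ⟨z, hz⟩ := exists_isWordValue op x₀ (w * s i * s j)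
    have hz' := hz
    rw [mul_s_comm hij] at hz'
    have e1 := IH hi hx (.step (by
      rw [mem_Des_iff, mul_s_apply, mul_s_apply, Equiv.swap_apply_of_ne_of_ne (by omega) (by omega),
        Equiv.swap_apply_of_ne_of_ne (by omega) (by omega)]
      exact hj) hz)
    have e2 := IH hj hy (.step (by
      rw [mem_Des_iff, mul_s_apply, mul_s_apply, Equiv.swap_apply_of_ne_of_ne (by omega) (by omega),
        Equiv.swap_apply_of_ne_of_ne (by omega) (by omega)]
      exact hi) hz')
    rw [e1, e2, hcomm i j hij]
  have near : ∀ {i x y}, i ∈ Des w → i + 1 ∈ Des w → IsWordValue op x₀ (w * s i) x →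
      IsWordValue op x₀ (w * s (i + 1)) y → op i x = op (i + 1) y := by
    intro i x y hi hj hx hy
    obtain ⟨z, hz⟩ := exists_isWordValue op x₀ (w * s i * s (i + 1) * s i)
    have hz' := hz
    rw [mul_s_braid] at hz'
    have s0 : Equiv.swap i (i + 1) (i + 2) = i + 2 :=
      Equiv.swap_apply_of_ne_of_ne (by omega) (by omega)
    have t0 : Equiv.swap (i + 1) (i + 2) i = i :=
      Equiv.swap_apply_of_ne_of_ne (by omega) (by omega)
    rw [mem_Des_iff] at hi hj
    rw [IH hi hx (.step (by simpa [mem_Des_iff, coe_s, add_assoc, s0, t0] using hj.trans hi)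
        (.step (by simpa [mem_Des_iff, coe_s, add_assoc, s0, t0] using hj) hz)),
      IH hj hy (.step (by simpa [mem_Des_iff, coe_s, add_assoc, s0, t0] using hj.trans hi)
        (.step (by simpa [mem_Des_iff, coe_s, add_assoc, s0, t0] using hi) hz')), hbraid]
  cases hx with
  | one =>
    cases hy with
    | one => rfl
    | step hj _ => simp [mem_Des_iff] at hj
  | step hi hx =>
    cases hy with
    | one => simp [mem_Des_iff] at hi
    | step hj hy =>
      rename_i x i y j
      rcases lt_trichotomy i j with h | rfl | h
      · rcases Nat.lt_or_ge (i + 1) j with h' | h'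
        · exact far h' hi hj hx hy
        · obtain rfl : j = i + 1 := by omega
          exact near hi hj hx hy
      · rw [IH hi hx hy]
      · rcases Nat.lt_or_ge (j + 1) i with h' | h'
        · exact (far h' hj hi hy hx).symm
        · obtain rfl : i = j + 1 := by omega
          exact (near hj hi hy hx).symm

/-- The value `op_{i_1} (⋯ (op_{i_k} x₀))` for a reduced word `w = s_{i_k} ⋯ s_{i_1}`. -/
noncomputable def wordValue (op : ℕ → α → α) (x₀ : α) (w : SInf) : α :=
  (exists_isWordValue op x₀ w).choose

theorem wordValue_spec (op : ℕ → α → α) (x₀ : α) (w : SInf) :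
    IsWordValue op x₀ w (wordValue op x₀ w) :=
  (exists_isWordValue op x₀ w).choose_spec

theorem wordValue_one
    (hcomm : ∀ i j, i + 1 < j → ∀ x, op i (op j x) = op j (op i x))
    (hbraid : ∀ i x, op i (op (i + 1) (op i x)) = op (i + 1) (op i (op (i + 1) x))) (x₀ : α) :
    wordValue op x₀ 1 = x₀ :=
  (wordValue_spec op x₀ 1).unique hcomm hbraid .one

theorem wordValue_of_mem_Des
    (hcomm : ∀ i j, i + 1 < j → ∀ x, op i (op j x) = op j (op i x))
    (hbraid : ∀ i x, op i (op (i + 1) (op i x)) = op (i + 1) (op i (op (i + 1) x))) (x₀ : α)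
    {w : SInf} {i : ℕ} (hi : i ∈ Des w) :
    wordValue op x₀ w = op i (wordValue op x₀ (w * s i)) :=
  (wordValue_spec op x₀ w).unique hcomm hbraid (.step hi (wordValue_spec op x₀ _))

end WordValue

/-! ### Dual functionals: separation and finiteness. -/

/-- The functional `f ↦ (N_{i_1} ⋯ N_{i_k} f)(0)` for a reduced word `w = s_{i_1} ⋯ s_{i_k}`. -/
noncomputable def dual (w : SInf) : MvPolynomial ℕ ℤ →ₗ[ℤ] ℤ :=
  wordValue (fun i φ => φ ∘ₗ NLin i) (lcoeff ℤ 0) w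

theorem dual_one (f : MvPolynomial ℕ ℤ) : dual 1 f = f.coeff 0 := by
  rw [dual, wordValue_one]
  · rfl
  · exact fun i j h φ => LinearMap.ext fun f => congrArg φ (N_comm h f).symm
  · exact fun i φ => LinearMap.ext fun f => congrArg φ (N_braid i f)

theorem dual_of_mem_Des {w : SInf} {i : ℕ} (hi : i ∈ Des w) (f : MvPolynomial ℕ ℤ) :
    dual w f = dual (w * s i) (N i f) := by
  rw [dual, wordValue_of_mem_Des _ _ _ hi]
  · rfl
  · exact fun i j h φ => LinearMap.ext fun f => congrArg φ (N_comm h f).symm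
  · exact fun i φ => LinearMap.ext fun f => congrArg φ (N_braid i f)

/-- Every functional also vanishes on each `N i f`, which has smaller degree unless zero. By
induction all `N i f` vanish, so `f` is constant, and `dual 1` reads off the constant. -/
theorem eq_zero_of_forall_dual_eq_zero {f : MvPolynomial ℕ ℤ} (h : ∀ w, dual w f = 0) :
    f = 0 := by
  induction hd : f.totalDegree using Nat.strong_induction_on generalizing f with
  | _ d ih =>
  have hN : ∀ i, N i f = 0 := fun i => by
    by_contra hi
    refine hi (ih _ (hd ▸ totalDegree_N_lt hi) (fun w => ?_) rfl)
    by_cases hw : i ∈ Des w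
    · rw [dual_of_mem_Des hw, N_N_self, map_zero]
    · have := dual_of_mem_Des (mem_Des_mul_s.2 hw) f
      rw [mul_s_mul_s, h] at this
      exact this.symm
  rw [eq_C_of_forall_N_eq_zero hN, ← dual_one, h, C_0]

theorem finite_dual_ne_zero (f : MvPolynomial ℕ ℤ) : {w | dual w f ≠ 0}.Finite := by
  induction hd : f.totalDegree using Nat.strong_induction_on generalizing f with
  | _ d ih =>
  refine (((finite_N_ne_zero f).biUnion fun i hi =>
    (ih _ (hd ▸ totalDegree_N_lt hi) (N i f) rfl).image (· * s i)).insert 1).subset ?_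
  intro w hw
  by_cases h : ∃ i, i ∈ Des w
  · obtain ⟨i, hi⟩ := h
    have hw' : dual (w * s i) (N i f) ≠ 0 := dual_of_mem_Des hi f ▸ hw
    refine Or.inr (Set.mem_biUnion (x := i) (fun h0 => hw' ?_) ⟨w * s i, hw', mul_s_mul_s w i⟩)
    rw [h0, map_zero]
  · exact Or.inl (eq_one_of_Des_eq_empty (not_exists.1 h))

/-! ### Independence of the recursion from its starting long element. -/

/-- The Schubert polynomial of `w₀ n * u`, for `u` a permutation of the first `n` letters. -/
noncomputable def staircaseValue (n : ℕ) (u : SInf) : MvPolynomial ℕ ℤ :=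
  wordValue N (∏ k ∈ Finset.range n, X k ^ (n - 1 - k)) u

theorem staircaseValue_one (n : ℕ) :
    staircaseValue n 1 = ∏ k ∈ Finset.range n, X k ^ (n - 1 - k) :=
  wordValue_one (fun _ _ h f => N_comm h f) N_braid _

theorem staircaseValue_of_mem_Des (n : ℕ) {u : SInf} {i : ℕ} (hi : i ∈ Des u) :
    staircaseValue n u = N i (staircaseValue n (u * s i)) :=
  wordValue_of_mem_Des (fun _ _ h f => N_comm h f) N_braid _ hi

theorem N_X_mul {i : ℕ} {f : MvPolynomial ℕ ℤ} (hf : rename (Equiv.swap i (i + 1)) f = f) :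
    N i (X i * f) = f := by
  rw [N_eq_iff, map_mul, hf, rename_X, Equiv.swap_apply_left, sub_mul]

/-- The cycle `s_0 s_1 ⋯ s_{j-1}`. -/
def cyc : ℕ → SInf
  | 0 => 1
  | j + 1 => cyc j * s j

theorem cyc_apply (j k : ℕ) :
    (cyc j).1 k = if k < j then k + 1 else if k = j then 0 else k := by
  induction j generalizing k with
  | zero => simp +contextual [cyc]
  | succ j ih =>
    rw [cyc, mul_s_apply, ih, Equiv.swap_apply_def]
    grind

/-- Each new letter applies `N j` to `X j` times a polynomial symmetric in `X j` and `X (j + 1)`,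
which removes that factor. At `j = n` the staircase for `n + 1` has become the one for `n`. -/
theorem staircaseValue_cyc {n j : ℕ} (hj : j ≤ n) :
    staircaseValue (n + 1) (cyc j)
      = ∏ k ∈ Finset.range (n + 1), X k ^ (if k < j then n - 1 - k else n - k) := by
  induction j with
  | zero => simp [cyc, staircaseValue_one]
  | succ j ih =>
    have hd : j ∈ Des (cyc (j + 1)) := by
      simp [mem_Des_iff, cyc_apply]
    have hA : j ∈ Finset.range (n + 1) := Finset.mem_range.2 (by omega)
    have hB : j + 1 ∈ (Finset.range (n + 1)).erase j :=
      Finset.mem_erase.2 ⟨by omega, Finset.mem_range.2 (by omega)⟩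
    rw [staircaseValue_of_mem_Des _ hd, cyc, mul_s_mul_s, ih (by omega)]
    refine Eq.trans (congrArg (N j) ?_) (N_X_mul ?_)
    · rw [← Finset.mul_prod_erase _ _ hA, ← Finset.mul_prod_erase _ _ hA, ← mul_assoc,
        ← pow_succ', if_neg (lt_irrefl j), if_pos (Nat.lt_succ_self j),
        show n - 1 - j + 1 = n - j by omega]
      congr 1
      refine Finset.prod_congr rfl fun k hk => ?_
      have := Finset.ne_of_mem_erase hk
      congr 1
      grind
    · rw [← Finset.mul_prod_erase _ _ hA, ← Finset.mul_prod_erase _ _ hB, map_mul, map_mul,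
        map_pow, map_pow, rename_X, rename_X, Equiv.swap_apply_left, Equiv.swap_apply_right,
        if_pos (Nat.lt_succ_self j), if_neg (lt_irrefl (j + 1)), map_prod,
        show n - (j + 1) = n - 1 - j by omega, mul_left_comm]
      congr 2
      refine Finset.prod_congr rfl fun k hk => ?_
      simp only [Finset.mem_erase] at hk
      rw [map_pow, rename_X, Equiv.swap_apply_of_ne_of_ne hk.2.1 hk.1]

theorem w₀_apply (n k : ℕ) : (w₀ n).1 k = if k < n then n - 1 - k else k := rfl

theorem w₀_mul_w₀ (n : ℕ) : w₀ n * w₀ n = 1 := by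
  apply Subtype.ext
  ext k
  change (w₀ n).1 ((w₀ n).1 k) = k
  simp only [w₀_apply]
  grind

theorem w₀_succ (n : ℕ) : w₀ (n + 1) = cyc n * w₀ n := by
  apply Subtype.ext
  ext k
  change (w₀ (n + 1)).1 k = (cyc n).1 ((w₀ n).1 k)
  simp only [w₀_apply, cyc_apply]
  grind

theorem apply_lt_of_fixed {w : SInf} {n : ℕ} (hn : ∀ k, n ≤ k → w.1 k = k) {k : ℕ} (hk : k < n) :
    w.1 k < n := by
  by_contra h
  have := w.1.injective (hn _ (not_lt.1 h))
  omega

theorem lt_of_mem_Des {w : SInf} {n : ℕ} (hn : ∀ k, n ≤ k → w.1 k = k) {i : ℕ}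
    (hi : i ∈ Des w) : i + 1 < n := by
  rw [mem_Des_iff] at hi
  by_contra h
  have h1 := hn (i + 1) (by omega)
  by_cases hin : i < n
  · have := apply_lt_of_fixed hn hin
    omega
  · have := hn i (by omega)
    omega

theorem mul_s_fixed {w : SInf} {n : ℕ} (hn : ∀ k, n ≤ k → w.1 k = k) {i : ℕ}
    (hi : i ∈ Des w) : ∀ k, n ≤ k → (w * s i).1 k = k := fun k hk => by
  have := lt_of_mem_Des hn hi
  rw [mul_s_apply, Equiv.swap_apply_of_ne_of_ne (by omega) (by omega), hn k hk]

/-- On values below `n`, `cyc n` preserves order, so descents of `u` remain descents of `cyc n * u`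
and the same operators can be stripped from both sides. -/
theorem staircaseValue_cyc_mul {n : ℕ} {u : SInf} (hn : ∀ k, n ≤ k → u.1 k = k) :
    staircaseValue (n + 1) (cyc n * u) = staircaseValue n u := by
  induction hm : displacement u using Nat.strong_induction_on generalizing u with
  | _ m ih =>
  by_cases h : ∃ i, i ∈ Des u
  · obtain ⟨i, hi⟩ := h
    have hin := lt_of_mem_Des hn hi
    have hd : i ∈ Des (cyc n * u) := by
      change (cyc n).1 (u.1 (i + 1)) < (cyc n).1 (u.1 i)
      rw [cyc_apply, cyc_apply, if_pos (apply_lt_of_fixed hn hin),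
        if_pos (apply_lt_of_fixed hn (by omega))]
      exact Nat.succ_lt_succ hi
    rw [staircaseValue_of_mem_Des _ hi, staircaseValue_of_mem_Des _ hd, mul_assoc,
      ih _ (hm ▸ displacement_mul_s_lt hi) (mul_s_fixed hn hi) rfl]
  · rw [eq_one_of_Des_eq_empty (not_exists.1 h), mul_one, staircaseValue_cyc le_rfl,
      staircaseValue_one, Finset.prod_range_succ]
    simp only [lt_irrefl, if_false, Nat.sub_self, pow_zero, mul_one]
    exact Finset.prod_congr rfl fun k hk => by rw [if_pos (Finset.mem_range.1 hk)]

theorem staircaseValue_eq_of_le {w : SInf} {m n : ℕ} (hm : ∀ k, m ≤ k → w.1 k = k) (h : m ≤ n) :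
    staircaseValue n (w₀ n * w) = staircaseValue m (w₀ m * w) := by
  induction n, h using Nat.le_induction with
  | base => rfl
  | succ n hmn ih =>
    rw [w₀_succ, mul_assoc, staircaseValue_cyc_mul, ih]
    intro k hk
    change (w₀ n).1 (w.1 k) = k
    rw [hm k (by omega), w₀_apply, if_neg (by omega)]

theorem IsSchubert.exists_eq_staircaseValue {w : SInf} {f : MvPolynomial ℕ ℤ}
    (h : IsSchubert w f) :
    ∃ n, (∀ k, n ≤ k → w.1 k = k) ∧ f = staircaseValue n (w₀ n * w) := by
  induction h with
  | long n =>
    refine ⟨n, fun k hk => by rw [w₀_apply, if_neg (by omega)], ?_⟩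
    rw [w₀_mul_w₀, staircaseValue_one]
  | @step w f i _ hi ih =>
    obtain ⟨n, hn, rfl⟩ := ih
    refine ⟨n, mul_s_fixed hn hi, ?_⟩
    have hin := lt_of_mem_Des hn hi
    -- Left multiplication by `w₀ n` reverses the order of the values below `n`, so the descent of
    -- `w` is an ascent of `w₀ n * w`.
    have hd : i ∈ Des (w₀ n * (w * s i)) := by
      rw [← mul_assoc, mem_Des_mul_s]
      change ¬ (w₀ n).1 (w.1 (i + 1)) < (w₀ n).1 (w.1 i)
      have h1 := apply_lt_of_fixed hn hin
      have h2 := apply_lt_of_fixed hn (show i < n by omega)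
      rw [w₀_apply, w₀_apply, if_pos h1, if_pos h2]
      rw [mem_Des_iff] at hi
      omega
    rw [staircaseValue_of_mem_Des _ hd, mul_assoc, mul_s_mul_s]

theorem IsSchubert.unique {w : SInf} {f g : MvPolynomial ℕ ℤ} (hf : IsSchubert w f)
    (hg : IsSchubert w g) : f = g := by
  obtain ⟨m, hm, rfl⟩ := hf.exists_eq_staircaseValue
  obtain ⟨n, hn, rfl⟩ := hg.exists_eq_staircaseValue
  rcases le_total m n with h | h
  · exact (staircaseValue_eq_of_le hm h).symm
  · exact staircaseValue_eq_of_le hn h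

/-! ### Schubert polynomials and their duality with the functionals. -/

theorem isSchubert_schubert (w : SInf) : IsSchubert w (schubert w) :=
  (exists_isSchubert w).choose_spec

theorem schubert_one : schubert 1 = 1 := by
  refine (isSchubert_schubert 1).unique ?_
  have h := IsSchubert.long 0
  have e : w₀ 0 = 1 := by
    apply Subtype.ext
    ext k
    simp [w₀_apply]
  rwa [e, Finset.range_zero, Finset.prod_empty] at h

theorem N_schubert_of_mem_Des {w : SInf} {i : ℕ} (hi : i ∈ Des w) :
    N i (schubert w) = schubert (w * s i) :=
  (IsSchubert.step i (isSchubert_schubert w) hi).unique (isSchubert_schubert _)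

/-- Here `schubert w` is itself in the image of `N i`, and `N i` squares to zero. -/
theorem N_schubert_of_notMem_Des {w : SInf} {i : ℕ} (hi : i ∉ Des w) :
    N i (schubert w) = 0 := by
  have h := N_schubert_of_mem_Des (mem_Des_mul_s.2 hi)
  rw [mul_s_mul_s] at h
  rw [← h, N_N_self]

theorem schubert_ne_zero (w : SInf) : schubert w ≠ 0 := by
  induction hm : displacement w using Nat.strong_induction_on generalizing w with
  | _ m ih =>
  by_cases h : ∃ i, i ∈ Des w
  · obtain ⟨i, hi⟩ := h
    intro h0
    refine ih _ (hm ▸ displacement_mul_s_lt hi) _ rfl ?_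
    rw [← N_schubert_of_mem_Des hi, h0, ← NLin_apply, map_zero]
  · rw [eq_one_of_Des_eq_empty (not_exists.1 h), schubert_one]
    exact one_ne_zero

theorem IsSchubert.exists_isHomogeneous {w : SInf} {f : MvPolynomial ℕ ℤ}
    (h : IsSchubert w f) : ∃ d, f.IsHomogeneous d := by
  induction h with
  | long n => exact ⟨_, .prod _ _ (fun k => n - 1 - k) fun k _ => isHomogeneous_X_pow k _⟩
  | step i _ _ ih =>
    obtain ⟨d, hd⟩ := ih
    exact exists_isHomogeneous_N hd i

/-- At a descent, `N i` sends this homogeneous polynomial to a nonzero one of smaller degree, so its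
degree is positive. -/
theorem coeff_zero_schubert {w : SInf} (hw : w ≠ 1) : (schubert w).coeff 0 = 0 := by
  obtain ⟨i, hi⟩ : ∃ i, i ∈ Des w := by
    by_contra h
    exact hw (eq_one_of_Des_eq_empty (not_exists.1 h))
  obtain ⟨d, hd⟩ := (isSchubert_schubert w).exists_isHomogeneous
  have h := totalDegree_N_lt (N_schubert_of_mem_Des hi ▸ schubert_ne_zero (w * s i))
  rw [hd.totalDegree (schubert_ne_zero w)] at h
  exact hd.coeff_eq_zero (by rw [map_zero]; omega)

-- Strip a descent `i` of `v`. If `w` shares it, both permutations shrink; if not, `N i` kills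
-- `schubert w`. At `v = 1` only the constant term is left.
open Classical in
theorem dual_schubert (v w : SInf) : dual v (schubert w) = if w = v then 1 else 0 := by
  induction hm : displacement v using Nat.strong_induction_on generalizing v w with
  | _ m ih =>
  by_cases h : ∃ i, i ∈ Des v
  · obtain ⟨i, hi⟩ := h
    rw [dual_of_mem_Des hi]
    by_cases hw : i ∈ Des w
    · rw [N_schubert_of_mem_Des hw, ih _ (hm ▸ displacement_mul_s_lt hi) _ _ rfl]
      simp only [mul_left_inj]
    · rw [N_schubert_of_notMem_Des hw, map_zero, if_neg]
      rintro rfl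
      exact hw hi
  · rw [eq_one_of_Des_eq_empty (not_exists.1 h), dual_one]
    split_ifs with hw
    · rw [hw, schubert_one, coeff_zero_one]
    · exact coeff_zero_schubert hw

theorem dual_sum_schubert (c : SInf →₀ ℤ) (v : SInf) :
    dual v (c.sum fun w a => a • schubert w) = c v := by
  classical
  simp only [map_finsuppSum, map_smul, dual_schubert, smul_eq_mul, mul_ite, mul_one, mul_zero]
  exact Finsupp.sum_ite_self_eq' c v

/-! ### Existence and uniqueness of expansions. -/

/-- The coefficients in the expansion of `f` in Schubert polynomials. -/
noncomputable def schubertCoeff (f : MvPolynomial ℕ ℤ) : SInf →₀ ℤ :=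
  Finsupp.ofSupportFinite (fun w => dual w f) (finite_dual_ne_zero f)

theorem eq_sum_schubert_iff {f : MvPolynomial ℕ ℤ} {c : SInf →₀ ℤ} :
    (f = c.sum fun w a => a • schubert w) ↔ c = schubertCoeff f := by
  constructor
  · rintro rfl
    ext v
    exact (dual_sum_schubert c v).symm
  · rintro rfl
    rw [← sub_eq_zero]
    refine eq_zero_of_forall_dual_eq_zero fun v => ?_
    rw [map_sub, dual_sum_schubert]
    exact sub_self _

theorem isExpansion_iff {u v : SInf} {c : SInf →₀ ℤ} :
    IsExpansion u v c ↔ c = schubertCoeff (schubert u * schubert v) :=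
  eq_sum_schubert_iff

/-- Existence makes the `Classical.epsilon` choice a genuine expansion; uniqueness then identifies
it. -/
theorem structureCoeff_eq (u v : SInf) :
    structureCoeff u v = schubertCoeff (schubert u * schubert v) :=
  isExpansion_iff.1 (Classical.epsilon_spec ⟨_, isExpansion_iff.2 rfl⟩)

end Schubert

theorem mainTheorem8 (u v : Schubert.SInf) (i : ℕ)
    (hi : i ∉ Schubert.Des u ∪ Schubert.Des v) :
    (∃! c : Schubert.SInf →₀ ℤ, Schubert.IsExpansion u v c) ∧
      ∀ p : Schubert.SInf, i ∈ Schubert.Des p → Schubert.structureCoeff u v p = 0 := by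
  rw [Set.mem_union, not_or] at hi
  refine ⟨⟨_, Schubert.isExpansion_iff.2 rfl, fun c hc => Schubert.isExpansion_iff.1 hc⟩,
    fun p hp => ?_⟩
  rw [Schubert.structureCoeff_eq]
  change Schubert.dual p _ = 0
  -- The functional at `p` factors through `N i`. The factor for `v` is symmetric and pulls out of
  -- `N i`, which then annihilates the factor for `u`.
  rw [Schubert.dual_of_mem_Des hp, Schubert.N_mul_of_rename_eq
    (Schubert.N_eq_zero_iff.1 (Schubert.N_schubert_of_notMem_Des hi.2)),
    Schubert.N_schubert_of_notMem_Des hi.1, zero_mul, map_zero]
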